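/- Let spacetime be $\mathbb R\times\mathbb R^3$ and let $\widetilde G$ be the Bargmann group: elements $(\theta,\tau,a,v,R)$ with $\theta,\tau\in\mathbb R$, $a,v\in\mathbb R^3$, $R\in SO(3)$, acting on spacetime by $(t,x)\mapsto(t+\tau,\,Rx+tv+a)$, whose product is composition with the cocycle $v'\cdot R'a+\tfrac12|v'|^2\tau$ added to $\theta'+\theta$. Let $\mathcal H$ be a complex Hilbert space, $\Omega\in\mathcal H$ a unit vector, $U$ a strongly continuous unitary representation of $\widetilde G$ on $\mathcal H$, $\mathcal O\mapsto\mathcal F(\mathcal O)$ an assignment of von Neumann algebras on $\mathcal H$ to the bounded open sets of spacetime, and $f\mapsto\hat\psi(f)$ a family of closed densely defined operators indexed by $f\in C_c^\infty(\mathbb R\times\mathbb R^3;\mathbb C)$, with $\hat\psi^\dagger(f)=\hat\psi(f)^*$. Write $U(\theta)=e^{i\theta\hat M}$ for the central subgroup and $e^{it\hat H}$ for the time translations. Assume: 1. (isotony) $\mathcal O_1\subseteq\mathcal O_2$ implies $\mathcal F(\mathcal O_1)\subseteq\mathcal F(\mathcal O_2)$; 2. (covariance) $U(g)\mathcal F(\mathcal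 O)U(g)^*=\mathcal F(g\cdot\mathcal O)$ for $g\in\widetilde G$, and $\mathcal H$ is the Hilbert direct sum of the eigenspaces of $\hat M$; 3. (generation) $\mathcal F(\mathcal O)$ is the smallest von Neumann algebra to which all $\hat\psi(f)$ with $\operatorname{supp}f\subseteq\mathcal O$ are affiliated; 4. (positive energy) $\sigma(\hat H)\subseteq[0,\infty)$; 5. (vacuum) $\Omega$ is invariant under all space and time translations, and every vector with this property is a multiple of $\Omega$; 6. (mass charge) there is $m_0>0$ with $U(\theta)\hat\psi(f)U(\theta)^{-1}=e^{-i\theta m_0}\hat\psi(f)$ and $U(\theta)\hat\psi^\dagger(f)U(\theta)^{-1}=e^{i\theta m_0}\hat\psi^\dagger(f)$ for all $\theta\in\mathbb R$ and all $f$; 7. (time-zero fields) there are a dense subspace $\mathcal D\ni\Omega$ with $\hat H\mathcal D\subseteq\mathcal D$, contained in the domains of $\hat H$ and of all $\hat\psi(\chi\otimes g)$, $(\chi\otimes g)(t,x)=\chi(t)g(x)$, and linear maps $\hat\psi_0(g),\hat\psi_0^\dagger(g):\mathcal D\to\mathcal D$ for $g\in C_c^\infty(\mathbb R^3;\mathbb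 C)$, adjoint to each other on $\mathcal D$, such that $\hat\psi(\chi_n\otimes g)\Psi\to\hat\psi_0(g)\Psi$ for every $\Psi\in\mathcal D$ and every sequence $\chi_n\in C_c^\infty(\mathbb R;\mathbb C)$ with $\int\chi_n=1$, $\chi_n\to\delta_0$ as distributions and supports shrinking to $\{0\}$; 8. (equal-time CCR) on $\mathcal D$, for all $g_1,g_2\in C_c^\infty(\mathbb R^3;\mathbb C)$, $[\hat\psi_0(g_1),\hat\psi_0^\dagger(g_2)]=\int\overline{g_1}\,g_2\,d^3x\cdot\mathbb 1$ and $[\hat\psi_0(g_1),\hat\psi_0(g_2)]=0$. Then for every nonempty bounded open $\mathcal O\subset\mathbb R\times\mathbb R^3$ whose complement has nonempty interior: (i) $\Omega$ is not separating for $\mathcal F(\mathcal O)$: some nonzero $A\in\mathcal F(\mathcal O)$ satisfies $A\Omega=0$; (ii) the Tomita–Takesaki modular flow of $\mathcal F(\mathcal O)$ relative to $\Omega$ is undefined: there is no densely defined conjugate-linear operator $S$ with domain $\mathcal F(\mathcal O)\Omega$ and $S(A\Omega)=A^*\Omega$ for all $A\in\mathcal F(\mathcal O)$, i.e. the Tomita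 operator from which the modular operator and flow are built does not exist. No commutativity of the algebras $\mathcal F(\mathcal O_1),\mathcal F(\mathcal O_2)$ of separated regions is assumed; in particular the result covers every net that satisfies, in addition, any form of equal-time locality. -/

import Mathlib

open scoped ComplexConjugate Distributions LinearPMap
open Filter Topology MeasureTheory

noncomputable section

namespace GalileanAQFT

/-- Euclidean three-space. -/
abbrev Space : Type := EuclideanSpace ℝ (Fin 3)

/-- Newtonian spacetime; points are written `(t, x)`, time first. -/
abbrev Spacetime : Type := ℝ × Space

/-- Proper rotations of three-space. -/
abbrev Rotation : Type := Matrix.specialOrthogonalGroup (Fin 3) ℝ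

/-- The action of a rotation matrix on a vector. -/
def rotate (R : Rotation) (x : Space) : Space :=
  WithLp.toLp 2 ((R : Matrix (Fin 3) (Fin 3) ℝ).mulVec x.ofLp)

theorem rotate_one (x : Space) : rotate 1 x = x := by
  simp [rotate]

theorem rotate_mul (R S : Rotation) (x : Space) : rotate (R * S) x = rotate R (rotate S x) := by
  simp [rotate, Matrix.mulVec_mulVec]

theorem rotate_add (R : Rotation) (x y : Space) : rotate R (x + y) = rotate R x + rotate R y := by
  simp [rotate, Matrix.mulVec_add]

theorem rotate_neg (R : Rotation) (x : Space) : rotate R (-x) = -rotate R x := by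
  simp [rotate, Matrix.mulVec_neg]

theorem rotate_smul (R : Rotation) (c : ℝ) (x : Space) : rotate R (c • x) = c • rotate R x := by
  simp [rotate, Matrix.mulVec_smul]

theorem rotate_zero (R : Rotation) : rotate R 0 = 0 := by
  simp [rotate]

theorem inner_rotate (R : Rotation) (x y : Space) :
    inner ℝ (rotate R x) (rotate R y) = inner ℝ x y := by
  have h : (R : Matrix (Fin 3) (Fin 3) ℝ).transpose * (R : Matrix (Fin 3) (Fin 3) ℝ) = 1 := by
    have := (Matrix.mem_specialOrthogonalGroup_iff.1 R.2).1
    exact Matrix.mem_orthogonalGroup_iff' (Fin 3) ℝ |>.1 this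
  simp only [rotate, EuclideanSpace.inner_eq_star_dotProduct, star_trivial]
  rw [Matrix.dotProduct_mulVec, Matrix.vecMul_mulVec, h]
  simp

/-- The Bargmann group: the central extension by `ℝ` of the proper Galilei group. The element
`(θ, τ, a, v, R)` covers the Galilei transformation `(t, x) ↦ (t + τ, R x + t v + a)`. -/
@[ext]
structure Bargmann : Type where
  phase : ℝ
  time : ℝ
  shift : Space
  boost : Space
  rot : Rotation

namespace Bargmann

/-- Product of the Galilei transformations, with the Bargmann cocycle
`v' · R' a + |v'|² τ / 2` added to the phases. -/
instance : Mul Bargmann where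
  mul g h :=
    { phase := g.phase + h.phase + inner ℝ g.boost (rotate g.rot h.shift)
        + inner ℝ g.boost g.boost * h.time / 2
      time := g.time + h.time
      shift := rotate g.rot h.shift + h.time • g.boost + g.shift
      boost := rotate g.rot h.boost + g.boost
      rot := g.rot * h.rot }

instance : One Bargmann where
  one := ⟨0, 0, 0, 0, 1⟩

instance : Inv Bargmann where
  inv g :=
    { phase := -g.phase + inner ℝ g.boost g.shift - inner ℝ g.boost g.boost * g.time / 2
      time := -g.time
      shift := rotate g.rot⁻¹ (g.time • g.boost - g.shift)
      boost := -rotate g.rot⁻¹ g.boost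
      rot := g.rot⁻¹ }

@[simp] theorem mul_phase (g h : Bargmann) : (g * h).phase =
    g.phase + h.phase + inner ℝ g.boost (rotate g.rot h.shift)
        + inner ℝ g.boost g.boost * h.time / 2 := rfl
@[simp] theorem mul_time (g h : Bargmann) : (g * h).time = g.time + h.time := rfl
@[simp] theorem mul_shift (g h : Bargmann) : (g * h).shift =
    rotate g.rot h.shift + h.time • g.boost + g.shift := rfl
@[simp] theorem mul_boost (g h : Bargmann) : (g * h).boost =
    rotate g.rot h.boost + g.boost := rfl
@[simp] theorem mul_rot (g h : Bargmann) : (g * h).rot = g.rot * h.rot := rfl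
@[simp] theorem one_phase : (1 : Bargmann).phase = 0 := rfl
@[simp] theorem one_time : (1 : Bargmann).time = 0 := rfl
@[simp] theorem one_shift : (1 : Bargmann).shift = 0 := rfl
@[simp] theorem one_boost : (1 : Bargmann).boost = 0 := rfl
@[simp] theorem one_rot : (1 : Bargmann).rot = 1 := rfl
@[simp] theorem inv_phase (g : Bargmann) : (g⁻¹).phase =
    -g.phase + inner ℝ g.boost g.shift - inner ℝ g.boost g.boost * g.time / 2 := rfl
@[simp] theorem inv_time (g : Bargmann) : (g⁻¹).time = -g.time := rfl
@[simp] theorem inv_shift (g : Bargmann) : (g⁻¹).shift =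
    rotate g.rot⁻¹ (g.time • g.boost - g.shift) := rfl
@[simp] theorem inv_boost (g : Bargmann) : (g⁻¹).boost = -rotate g.rot⁻¹ g.boost := rfl
@[simp] theorem inv_rot (g : Bargmann) : (g⁻¹).rot = g.rot⁻¹ := rfl

instance : Group Bargmann :=
  Group.ofLeftAxioms
    (by
      intro a b c
      ext1
      · simp only [mul_phase, mul_boost, mul_rot, mul_shift, mul_time, rotate_mul, rotate_add,
          rotate_smul, inner_add_left, inner_add_right, inner_smul_right, inner_rotate,
          real_inner_comm a.boost (rotate a.rot b.boost)]
        ring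
      · simp only [mul_time]; ring
      · simp only [mul_shift, mul_rot, mul_boost, mul_time, rotate_mul, rotate_add, rotate_smul,
          smul_add, add_smul]
        abel
      · simp only [mul_boost, mul_rot, rotate_mul, rotate_add]
        abel
      · simp only [mul_rot, mul_assoc])
    (by
      intro a
      ext1
      · simp [rotate_one]
      · simp
      · simp [rotate_one]
      · simp [rotate_one]
      · simp)
    (by
      intro a
      ext1
      · simp only [mul_phase, inv_phase, inv_boost, inv_rot, inner_neg_left, inner_neg_right,
          inner_rotate, one_phase]
        ring
      · simp
      · simp only [mul_shift, inv_shift, inv_rot, inv_boost, one_shift, smul_neg, ← rotate_smul,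
          ← rotate_neg, ← rotate_add]
        rw [show a.shift + -(a.time • a.boost) + (a.time • a.boost - a.shift) = 0 by abel,
          rotate_zero]
      · simp
      · simp)

/-- The product topology on the five parameters. -/
instance : TopologicalSpace Bargmann :=
  TopologicalSpace.induced
    (fun g => ((g.phase, g.time, g.shift, g.boost, g.rot) : ℝ × ℝ × Space × Space × Rotation))
    inferInstance

/-- The geometric action on spacetime; the central phase acts trivially. -/
instance : MulAction Bargmann Spacetime where
  smul g p := (p.1 + g.time, rotate g.rot p.2 + p.1 • g.boost + g.shift)
  one_smul p := by
    change (p.1 + 0, rotate 1 p.2 + p.1 • (0 : Space) + 0) = p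
    simp [rotate_one]
  mul_smul g h p := by
    change (p.1 + (g.time + h.time), rotate (g.rot * h.rot) p.2
        + p.1 • (rotate g.rot h.boost + g.boost)
        + (rotate g.rot h.shift + h.time • g.boost + g.shift)) =
      ((p.1 + h.time) + g.time, rotate g.rot (rotate h.rot p.2 + p.1 • h.boost + h.shift)
        + (p.1 + h.time) • g.boost + g.shift)
    refine Prod.ext ?_ ?_
    · simp only; ring
    · simp only [rotate_mul, rotate_add, rotate_smul, smul_add, add_smul]
      abel

/-- The central element with phase `θ`. -/
def central (θ : ℝ) : Bargmann := ⟨θ, 0, 0, 0, 1⟩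

/-- The translation by `τ` in time and `a` in space. -/
def translation (τ : ℝ) (a : Space) : Bargmann := ⟨0, τ, a, 0, 1⟩

end Bargmann

/-- Complex test functions `C_c^∞` on a real normed space. -/
abbrev Test (E : Type) [NormedAddCommGroup E] [NormedSpace ℝ E] : Type :=
  𝓓((⊤ : TopologicalSpace.Opens E), ℂ)

/-- The product test function `(χ ⊗ g)(t, x) = χ(t) g(x)`. -/
def Test.tensor (χ : Test ℝ) (g : Test Space) : Test Spacetime where
  toFun p := χ p.1 * g p.2
  contDiff' := (χ.contDiff.comp contDiff_fst).mul (g.contDiff.comp contDiff_snd)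
  hasCompactSupport' := by
    refine HasCompactSupport.of_support_subset_isCompact
      (χ.hasCompactSupport.isCompact.prod g.hasCompactSupport.isCompact) ?_
    intro p hp
    have hp' : χ p.1 * g p.2 ≠ 0 := hp
    exact ⟨subset_tsupport _ (left_ne_zero_of_mul hp'),
      subset_tsupport _ (right_ne_zero_of_mul hp')⟩
  tsupport_subset' := by simp

/-- A sequence of test functions of total integral one that approximates the Dirac distribution at
time zero: it converges to it as a distribution, with supports shrinking to `{0}`. -/
structure IsDeltaSequence (χ : ℕ → Test ℝ) : Prop where
  integral_eq_one : ∀ n, ∫ t, χ n t = 1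
  tendsto_dirac : ∀ φ : Test ℝ, Tendsto (fun n => ∫ t, χ n t * φ t) atTop (𝓝 (φ 0))
  support_shrinks : ∀ δ > 0, ∀ᶠ n in atTop, tsupport (χ n) ⊆ Metric.ball 0 δ

section Operators

variable {H : Type*} [NormedAddCommGroup H] [InnerProductSpace ℂ H] [CompleteSpace H]

/-- The resolvent set of an unbounded operator: those `z` for which `T - z` is a bijection from the
domain of `T` onto the space, with bounded inverse. -/
def resolventSet (T : H →ₗ.[ℂ] H) : Set ℂ :=
  {z | ∃ R : H →L[ℂ] H,
    (∀ y, ∃ h : R y ∈ T.domain, T ⟨R y, h⟩ - z • R y = y) ∧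
    ∀ x : T.domain, R (T x - z • (x : H)) = x}

/-- The spectrum of an unbounded operator. -/
def spectrum (T : H →ₗ.[ℂ] H) : Set ℂ := (resolventSet T)ᶜ

/-- The infinitesimal generator `A` of a one-parameter group `V t = exp (i t A)`: its domain is
the set of `x` whose orbit is differentiable at `0`, and `A x = -i (d/dt) V t x` at `t = 0`. -/
def generator (V : ℝ → H →L[ℂ] H) : H →ₗ.[ℂ] H where
  domain :=
    { carrier := {x | DifferentiableAt ℝ (fun t => V t x) 0}
      add_mem' := by
        intro x y hx hy
        have : (fun t => V t (x + y)) = (fun t => V t x) + fun t => V t y := by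
          funext t; simp
        change DifferentiableAt ℝ (fun t => V t (x + y)) 0
        rw [this]
        exact DifferentiableAt.add hx hy
      zero_mem' := by simp
      smul_mem' := by
        intro c x hx
        have : (fun t => V t (c • x)) = c • fun t => V t x := by
          funext t; simp
        change DifferentiableAt ℝ (fun t => V t (c • x)) 0
        rw [this]
        exact DifferentiableAt.const_smul hx c }
  toFun :=
    { toFun := fun x => -Complex.I • deriv (fun t => V t (x : H)) 0
      map_add' := by
        intro x y
        have : (fun t => V t ((x + y : _) : H)) = (fun t => V t (x : H)) + fun t => V t (y : H) := by
          funext t; simp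
        rw [this, deriv_add x.2 y.2, smul_add]
      map_smul' := by
        intro c x
        have : (fun t => V t ((c • x : _) : H)) = c • fun t => V t (x : H) := by
          funext t; simp
        rw [this, deriv_const_smul c x.2, RingHom.id_apply, smul_comm] }

/-- `T` is affiliated to `𝓐`: it is closed, densely defined and commutes with the bounded operators
in the commutant of `𝓐`. -/
structure IsAffiliated (T : H →ₗ.[ℂ] H) (𝓐 : VonNeumannAlgebra H) : Prop where
  dense : Dense (T.domain : Set H)
  closed : T.IsClosed
  commutes : ∀ B ∈ 𝓐.commutant, ∀ x : T.domain,
    ∃ h : B x ∈ T.domain, T ⟨B x, h⟩ = B (T x)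

/-- `V θ T (V θ)⁻¹ = exp (i θ q) T` for all `θ`, as an identity of unbounded operators. -/
def HasCharge (V : ℝ → H →L[ℂ] H) (T : H →ₗ.[ℂ] H) (q : ℝ) : Prop :=
  ∀ θ : ℝ, ∀ x : T.domain, ∃ h : V θ x ∈ T.domain,
    V θ (T x) = Complex.exp (Complex.I * θ * q) • T ⟨V θ x, h⟩

/-- `Ω` is separating for `𝓐`. -/
def IsSeparating (𝓐 : VonNeumannAlgebra H) (Ω : H) : Prop :=
  ∀ A ∈ 𝓐, A Ω = 0 → A = 0

/-- `S` is the Tomita operator of `𝓐` and `Ω`, from whose closure the modular operator and the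
modular flow are constructed: the densely defined conjugate-linear operator with domain
`𝓐 Ω` and `S (A Ω) = A* Ω`. -/
structure IsTomitaOperator (𝓐 : VonNeumannAlgebra H) (Ω : H)
    (S : H →ₛₗ.[starRingEnd ℂ] H) : Prop where
  dense : Dense (S.domain : Set H)
  domain_eq : (S.domain : Set H) = {x | ∃ A ∈ 𝓐, A Ω = x}
  apply_eq : ∀ A ∈ 𝓐, ∀ h : A Ω ∈ S.domain, S ⟨A Ω, h⟩ = star A Ω

end Operators

/-- A region of the net. -/
def IsRegion (O : Set Spacetime) : Prop := IsOpen O ∧ Bornology.IsBounded O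

/-- A Galilean net of local field algebras with positive energy, unique vacuum and canonical
fields. Commutativity of the algebras of separated regions is not required, so nets with any form
of equal-time locality are included. -/
structure GalileanNet (H : Type*) [NormedAddCommGroup H] [InnerProductSpace ℂ H]
    [CompleteSpace H] where
  /-- The local field algebras; only the values at bounded open sets are used. -/
  alg : Set Spacetime → VonNeumannAlgebra H
  U : Bargmann →* unitary (H →L[ℂ] H)
  Ω : H
  /-- The smeared fields `ψ(f)`, as unbounded operators; `ψ†(f)` is the adjoint of `ψ(f)`. -/
  ψ : Test Spacetime → H →ₗ.[ℂ] H
  U_continuous : ∀ x : H, Continuous fun g => (U g : H →L[ℂ] H) x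
  norm_vacuum : ‖Ω‖ = 1
  isotony : ∀ O₁ O₂, IsRegion O₁ → IsRegion O₂ → O₁ ⊆ O₂ → alg O₁ ≤ alg O₂
  covariance : ∀ g O, IsRegion O → ∀ A : H →L[ℂ] H,
    (U g : H →L[ℂ] H) * A * star (U g : H →L[ℂ] H) ∈ alg ((fun p => g • p) '' O) ↔ A ∈ alg O
  /-- The Hilbert space is the (closed) direct sum of the eigenspaces of the mass operator `M`,
  where `U (central θ) = exp (i θ M)`. -/
  mass_decomposition : Dense (Submodule.span ℂ {x : H | ∃ M : ℝ, ∀ θ : ℝ,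
    (U (Bargmann.central θ) : H →L[ℂ] H) x = Complex.exp (Complex.I * θ * M) • x} : Set H)
  /-- The fields smeared in `O` are affiliated to `alg O`. -/
  field_affiliated : ∀ O, IsRegion O → ∀ f : Test Spacetime, tsupport f ⊆ O →
    IsAffiliated (ψ f) (alg O)
  /-- The fields smeared in `O` generate `alg O`. -/
  field_generates : ∀ O, IsRegion O → ∀ 𝓐 : VonNeumannAlgebra H,
    (∀ f : Test Spacetime, tsupport f ⊆ O → IsAffiliated (ψ f) 𝓐) → alg O ≤ 𝓐
  /-- The Hamiltonian, `U (translation t 0) = exp (i t H)`, has spectrum in `[0, ∞)`. -/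
  positive_energy :
    spectrum (generator fun t => (U (Bargmann.translation t 0) : H →L[ℂ] H)) ⊆
      {z | 0 ≤ z.re ∧ z.im = 0}
  vacuum_invariant : ∀ τ a, (U (Bargmann.translation τ a) : H →L[ℂ] H) Ω = Ω
  vacuum_unique : ∀ x : H, (∀ τ a, (U (Bargmann.translation τ a) : H →L[ℂ] H) x = x) →
    ∃ c : ℂ, x = c • Ω

namespace GalileanNet

variable {H : Type*} [NormedAddCommGroup H] [InnerProductSpace ℂ H] [CompleteSpace H]

/-- The central one-parameter group `exp (i θ M)` generated by the mass operator. -/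
def massGroup (N : GalileanNet H) (θ : ℝ) : H →L[ℂ] H := N.U (Bargmann.central θ)

/-- The Hamiltonian. -/
def hamiltonian (N : GalileanNet H) : H →ₗ.[ℂ] H :=
  generator fun t => (N.U (Bargmann.translation t 0) : H →L[ℂ] H)

/-- The fields `ψ(f)` and `ψ†(f)` carry mass charges `-m₀` and `m₀`. -/
def FieldsHaveMassCharge (N : GalileanNet H) (m₀ : ℝ) : Prop :=
  ∀ f, HasCharge N.massGroup (N.ψ f) (-m₀) ∧ HasCharge N.massGroup (N.ψ f)† m₀

/-- Time-zero fields of a net on a dense domain that contains the vacuum and is stable under the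
Hamiltonian and under the time-zero fields. -/
structure TimeZeroFields (N : GalileanNet H) where
  dom : Submodule ℂ H
  dense : Dense (dom : Set H)
  vacuum_mem : N.Ω ∈ dom
  hamiltonian_stable : ∀ x ∈ dom, ∃ h : x ∈ N.hamiltonian.domain, N.hamiltonian ⟨x, h⟩ ∈ dom
  ψ₀ : Test Space → dom →ₗ[ℂ] dom
  ψ₀dag : Test Space → dom →ₗ[ℂ] dom
  adjoint : ∀ g (x y : dom), inner ℂ (ψ₀dag g x : H) (y : H) = inner ℂ (x : H) (ψ₀ g y : H)
  dom_le : ∀ χ g, dom ≤ (N.ψ (Test.tensor χ g)).domain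
  limit : ∀ χ : ℕ → Test ℝ, IsDeltaSequence χ → ∀ g (x : dom),
    Tendsto (fun n => N.ψ (Test.tensor (χ n) g) ⟨x, dom_le (χ n) g x.2⟩) atTop (𝓝 (ψ₀ g x : H))

/-- The equal-time canonical commutation relations. -/
def TimeZeroFields.CCR {N : GalileanNet H} (T : TimeZeroFields N) : Prop :=
  ∀ (g₁ g₂ : Test Space) (x : T.dom),
    T.ψ₀ g₁ (T.ψ₀dag g₂ x) - T.ψ₀dag g₂ (T.ψ₀ g₁ x) = (∫ y, conj (g₁ y) * g₂ y) • x ∧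
    T.ψ₀ g₁ (T.ψ₀ g₂ x) - T.ψ₀ g₂ (T.ψ₀ g₁ x) = 0

end GalileanNet

end GalileanAQFT

end

/-! The field `ψ(f)` lowers the mass by `m₀`, and there is nothing below the vacuum. Uniqueness of
the vacuum and the Bargmann cocycle force `Ω` to have mass zero (`act_central_vacuum`). A vector of
negative mass would have energy unbounded below under large boosts (`eq_zero_of_negative_mass`).
Hence `ψ(f) Ω = 0` whenever `Ω` lies in the domain (`field_vacuum`).

To pass to bounded operators, take the projection onto the graph of `ψ(f)`. Its off-diagonal entry
`A` belongs to the local algebra and kills `Ω`; if `A* Ω = 0` too, then `Ω` is orthogonal to the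
range of `ψ(f)` (`IsAffiliated.exists_annihilator`). Were this so for all such `f` supported in a
region meeting time zero, the limit would give `ψ₀†(g) Ω = 0` beside `ψ₀(g) Ω = 0`, against the
commutator `‖g‖² ≠ 0`. So some `A` has `A Ω = 0` and `A* Ω ≠ 0`, which refutes separation and the
Tomita operator together. Time translation carries this to every region. -/

noncomputable section

namespace GalileanAQFT

/-! ### Unbounded operators: positivity from the spectrum, and bounded parts of affiliated
operators. -/

section Operators

variable {H : Type*} [NormedAddCommGroup H] [InnerProductSpace ℂ H] [CompleteSpace H]

/-- A symmetric unbounded operator whose spectrum is contained in `[0, ∞)` is positive. -/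
theorem re_inner_apply_nonneg_of_spectrum (T : H →ₗ.[ℂ] H)
    (hsymm : ∀ x y : T.domain, inner ℂ (T x) (y : H) = inner ℂ (x : H) (T y))
    (hspec : spectrum T ⊆ {z | 0 ≤ z.re ∧ z.im = 0}) (x : T.domain) :
    0 ≤ (inner ℂ (x : H) (T x)).re := by
  have hres : ∀ l : ℝ, 0 < l → ∃ R : H →L[ℂ] H,
      (∀ y, ∃ h : R y ∈ T.domain, T ⟨R y, h⟩ + (l : ℂ) • R y = y) ∧
      ∀ x : T.domain, R (T x + (l : ℂ) • (x : H)) = x := by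
    intro l hl
    have : (-l : ℂ) ∈ resolventSet T := by
      by_contra h
      have := (hspec h).1
      simp at this
      linarith
    obtain ⟨R, h1, h2⟩ := this
    refine ⟨R, fun y => ?_, fun x => ?_⟩
    · obtain ⟨h, e⟩ := h1 y
      exact ⟨h, by simpa using e⟩
    · simpa using h2 x
  -- The first resolvent identity. Applied in both orders, it yields a two-sided inverse below.
  have hshift : ∀ l l' : ℝ, ∀ R R' : H →L[ℂ] H,
      (∀ y, ∃ h : R' y ∈ T.domain, T ⟨R' y, h⟩ + (l' : ℂ) • R' y = y) →
      (∀ x : T.domain, R (T x + (l : ℂ) • (x : H)) = x) →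
      R' = R + ((l : ℂ) - l') • (R * R') := by
    intro l l' R R' h1 h2
    ext y
    obtain ⟨h, e⟩ := h1 y
    have e2 := h2 ⟨R' y, h⟩
    have e3 : T ⟨R' y, h⟩ = y - (l' : ℂ) • R' y := eq_sub_of_add_eq e
    simp only [e3] at e2
    simp only [map_add, map_sub, map_smul] at e2
    simp only [add_apply, smul_apply, mul_apply_eq_comp]
    nth_rewrite 1 [← e2]
    module
  -- The bounded resolvent `R = (T + l)⁻¹` is shown to be positive; testing it on `(T + l) x` gives
  -- the bound, and `l → 0` finishes.
  have key : ∀ l : ℝ, 0 < l → 0 ≤ (inner ℂ (x : H) (T x)).re + l * ‖(x : H)‖ ^ 2 := by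
    intro l hl
    obtain ⟨R, h1, h2⟩ := hres l hl
    have hRsymm : R.toLinearMap.IsSymmetric := by
      intro y z
      obtain ⟨hy, ey⟩ := h1 y
      obtain ⟨hz, ez⟩ := h1 z
      change inner ℂ (R y) z = inner ℂ y (R z)
      conv_lhs => rw [← ez]
      conv_rhs => rw [← ey]
      rw [inner_add_left, inner_add_right, inner_smul_left, inner_smul_right,
        ← hsymm ⟨R y, hy⟩ ⟨R z, hz⟩]
      simp
    have hRsa : IsSelfAdjoint R := ContinuousLinearMap.isSelfAdjoint_iff_isSymmetric.2 hRsymm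
    have hpos : 0 ≤ R := by
      rw [StarOrderedRing.nonneg_iff_spectrum_nonneg (R := ℝ) R hRsa]
      intro μ hμ
      by_contra hneg
      push Not at hneg
      refine hμ ?_
      -- Formally `μ - R = μ (T + l - μ⁻¹) (T + l)⁻¹`, so for `μ < 0` its inverse is `μ⁻¹ (1 + μ⁻¹
      -- R')` with `R'` the resolvent at the shift `l - μ⁻¹ > 0`.
      have hl' : 0 < l - μ⁻¹ := by
        have := inv_lt_zero.2 hneg
        linarith
      obtain ⟨R', h1', h2'⟩ := hres _ hl'
      have e1 := hshift l _ R R' h1' h2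
      have e2 := hshift _ l R' R h1 h2'
      have hμ0 : (μ : ℂ) ≠ 0 := by exact_mod_cast hneg.ne
      have c1 : ((l : ℂ) - ((l - μ⁻¹ : ℝ) : ℂ)) = (μ : ℂ)⁻¹ := by push_cast; ring
      have c2 : (((l - μ⁻¹ : ℝ) : ℂ) - (l : ℂ)) = -(μ : ℂ)⁻¹ := by push_cast; ring
      rw [c1] at e1
      rw [c2] at e2
      have halg : (algebraMap ℝ (H →L[ℂ] H)) μ = (μ : ℂ) • 1 := by
        ext y; simp [Algebra.algebraMap_eq_smul_one]
      have f1 : R * R' = (μ : ℂ) • (R' - R) := by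
        have : R' - R = (μ : ℂ)⁻¹ • (R * R') := sub_eq_iff_eq_add'.2 e1
        rw [this, smul_smul, mul_inv_cancel₀ hμ0, one_smul]
      have f2 : R' * R = (μ : ℂ) • (R' - R) := by
        have : R - R' = -(μ : ℂ)⁻¹ • (R' * R) := sub_eq_iff_eq_add'.2 e2
        rw [← neg_sub, this, smul_neg, smul_smul, mul_neg, mul_inv_cancel₀ hμ0]
        simp
      rw [spectrum.mem_resolventSet_iff, halg]
      refine (⟨_, (μ : ℂ)⁻¹ • (1 + (μ : ℂ)⁻¹ • R'), ?_, ?_⟩ : (H →L[ℂ] H)ˣ).isUnit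
      · simp only [mul_smul_comm, sub_mul, mul_add, smul_mul_assoc, one_mul, mul_one, f1]
        match_scalars <;> field_simp <;> ring
      · simp only [mul_smul_comm, mul_sub, add_mul, smul_mul_assoc, one_mul, mul_one, f2]
        match_scalars <;> field_simp <;> ring
    have hp := ((ContinuousLinearMap.nonneg_iff_isPositive R).1 hpos).2 (T x + (l : ℂ) • (x : H))
    rw [ContinuousLinearMap.reApplyInnerSelf_apply, h2 x, inner_add_right, inner_smul_right] at hp
    simpa [inner_self_eq_norm_sq_to_K, ← Complex.ofReal_pow] using hp
  have hlim : Tendsto (fun l : ℝ => (inner ℂ (x : H) (T x)).re + l * ‖(x : H)‖ ^ 2) (𝓝[>] 0)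
      (𝓝 (inner ℂ (x : H) (T x)).re) := by
    have hc : Continuous fun l : ℝ => (inner ℂ (x : H) (T x)).re + l * ‖(x : H)‖ ^ 2 := by fun_prop
    simpa using (hc.tendsto 0).mono_left nhdsWithin_le_nhds
  exact ge_of_tendsto hlim (eventually_mem_nhdsWithin.mono key)

omit [CompleteSpace H] in
/-- The generator of a family of isometries is symmetric. -/
theorem generator_symmetric (V : ℝ → H →L[ℂ] H) (h0 : V 0 = 1)
    (hV : ∀ t x y, inner ℂ (V t x) (V t y) = inner ℂ x y) (x y : (generator V).domain) :
    inner ℂ (generator V x) (y : H) = inner ℂ (x : H) (generator V y) := by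
  have hx : DifferentiableAt ℝ (fun t => V t (x : H)) 0 := x.2
  have hy : DifferentiableAt ℝ (fun t => V t (y : H)) 0 := y.2
  have h := HasDerivAt.inner ℂ hx.hasDerivAt hy.hasDerivAt
  simp only [hV, h0, one_apply_eq_self] at h
  have h' := h.unique (hasDerivAt_const (0 : ℝ) (inner ℂ (x : H) (y : H)))
  change inner ℂ (-Complex.I • deriv (fun t => V t (x : H)) 0) (y : H) =
    inner ℂ (x : H) (-Complex.I • deriv (fun t => V t (y : H)) 0)
  rw [inner_smul_left, inner_smul_right]
  simp only [map_neg, Complex.conj_I]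
  linear_combination Complex.I * h'

/-- If a closed operator `T` affiliated to `𝓐` annihilates `Ω`, then the off-diagonal entry of the
projection onto the graph of `T` is an element of `𝓐` that annihilates `Ω`; its adjoint
annihilates `Ω` only if `Ω` is orthogonal to the range of `T`. -/
theorem IsAffiliated.exists_annihilator {T : H →ₗ.[ℂ] H} {𝓐 : VonNeumannAlgebra H}
    (hT : IsAffiliated T 𝓐) {Ω : H} (hΩ : Ω ∈ T.domain) (h0 : T ⟨Ω, hΩ⟩ = 0) :
    ∃ A ∈ 𝓐, A Ω = 0 ∧ (star A Ω = 0 → ∀ x : T.domain, inner ℂ Ω (T x) = 0) := by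
  let e := WithLp.prodContinuousLinearEquiv 2 ℂ H H
  let G : Submodule ℂ (WithLp 2 (H × H)) := T.graph.comap e.toLinearMap
  have hmem : ∀ u : WithLp 2 (H × H), u ∈ G ↔ ∃ y : T.domain, (y : H) = u.fst ∧ T y = u.snd :=
    fun u => T.mem_graph_iff
  have hG : IsClosed (G : Set (WithLp 2 (H × H))) := hT.closed.preimage e.continuous
  have : CompleteSpace G := hG.completeSpace_coe
  let P := G.starProjection
  let A : H →L[ℂ] H := (ContinuousLinearMap.snd ℂ H H).comp
    ((e : _ →L[ℂ] _).comp (P.comp ((e.symm : _ →L[ℂ] _).comp (ContinuousLinearMap.inl ℂ H H))))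
  have hA : ∀ x, A x = (P (WithLp.toLp 2 (x, 0))).snd := fun x => rfl
  have hPmem : ∀ u, P u ∈ G := fun u => G.starProjection_apply_mem u
  have hPsub : ∀ u, ∀ w ∈ G, inner ℂ w (u - P u) = 0 := fun u w hw =>
    (Submodule.mem_orthogonal _ _).1 (G.sub_starProjection_mem_orthogonal u) w hw
  refine ⟨A, ?_, ?_, ?_⟩
  -- Double commutant: `B` and `B*` in the commutant, acting diagonally, both preserve the graph, so
  -- they commute with its projection.
  · rw [← 𝓐.commutant_commutant, VonNeumannAlgebra.mem_commutant_iff]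
    intro B hB
    have hB' : star B ∈ 𝓐.commutant := star_mem hB
    ext x
    simp only [mul_apply_eq_comp, hA]
    set u : WithLp 2 (H × H) := WithLp.toLp 2 (x, 0)
    have hP : P (WithLp.toLp 2 (B x, 0)) = WithLp.toLp 2 (B (P u).fst, B (P u).snd) := by
      refine Submodule.eq_starProjection_of_mem_orthogonal ?_ ?_
      · obtain ⟨y, h1, h2⟩ := (hmem _).1 (hPmem u)
        obtain ⟨h, h3⟩ := hT.commutes B hB y
        refine (hmem _).2 ⟨⟨B y, h⟩, ?_, ?_⟩
        · exact congrArg B h1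
        · exact h3.trans (congrArg B h2)
      · rw [Submodule.mem_orthogonal]
        intro w hw
        obtain ⟨y, h1, h2⟩ := (hmem _).1 hw
        obtain ⟨h, h3⟩ := hT.commutes _ hB' y
        have hw' : (WithLp.toLp 2 (star B y, star B (T y)) : WithLp 2 (H × H)) ∈ G :=
          (hmem _).2 ⟨⟨_, h⟩, rfl, h3⟩
        have := hPsub u _ hw'
        rw [WithLp.prod_inner_apply] at this ⊢
        rw [ContinuousLinearMap.star_eq_adjoint] at this
        simp only [ContinuousLinearMap.adjoint_inner_left, h1, h2] at this
        simpa [u] using this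
    rw [hP]
    rfl
  · have hm : (WithLp.toLp 2 (Ω, 0) : WithLp 2 (H × H)) ∈ G := (hmem _).2 ⟨⟨Ω, hΩ⟩, rfl, h0⟩
    rw [hA, (Submodule.starProjection_eq_self_iff (K := G)).2 hm]
    rfl
  · intro hstar x
    set w : WithLp 2 (H × H) := WithLp.toLp 2 (0, Ω)
    -- Since `P` is self-adjoint, the first component of `P (0, Ω)` is `A* Ω`.
    have hfst : (P w).fst = 0 := by
      refine ext_inner_right ℂ fun y => ?_
      have h1 : inner ℂ Ω (A y) = 0 := by
        rw [← ContinuousLinearMap.adjoint_inner_left, ← ContinuousLinearMap.star_eq_adjoint, hstar,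
          inner_zero_left]
      have h2 := Submodule.inner_starProjection_left_eq_right G w (WithLp.toLp 2 (y, 0))
      rw [WithLp.prod_inner_apply, WithLp.prod_inner_apply] at h2
      simp only [w, inner_zero_left, inner_zero_right, zero_add, add_zero] at h2
      rw [inner_zero_left]
      exact h2.trans h1
    -- A graph point over `0` is `0`; hence `(0, Ω)` is orthogonal to the whole graph.
    have hP0 : P w = 0 := by
      obtain ⟨y, h1, h2⟩ := (hmem _).1 (hPmem w)
      have hy : y = 0 := Subtype.ext (h1.trans hfst)
      have hsnd : (P w).snd = 0 := by rw [← h2, hy, T.map_zero]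
      exact (WithLp.ofLp_injective 2) (Prod.ext hfst hsnd)
    have h := hPsub w (WithLp.toLp 2 ((x : H), T x)) ((hmem _).2 ⟨x, rfl, rfl⟩)
    rw [hP0, sub_zero, WithLp.prod_inner_apply] at h
    have h' : inner ℂ (T x) Ω = 0 := by simpa [w] using h
    exact inner_eq_zero_symm.1 h'

end Operators

/-! ### Relations among boosts, translations and central elements. -/

namespace Bargmann

/-- The boost by the velocity `v`. -/
def pureBoost (v : Space) : Bargmann := ⟨0, 0, 0, v, 1⟩

theorem translation_mul (p q : Spacetime) :
    translation p.1 p.2 * translation q.1 q.2 = translation (p + q).1 (p + q).2 := by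
  ext1
  · simp [translation]
  · simp [translation]
  · simp [translation, rotate_one, add_comm]
  · simp [translation, rotate_one]
  · simp [translation]

theorem translation_zero : translation 0 0 = 1 := rfl

theorem central_comm (θ : ℝ) (g : Bargmann) : central θ * g = g * central θ := by
  ext1 <;> simp [central, rotate_one, rotate_zero, add_comm]

/-- The cocycle at work, and the source of both mass arguments: the phase `v · a` at `τ = 0` fixes
the mass of the vacuum, the phase `|v|² τ / 2` at `a = 0` gives the kinetic term of a boosted
energy. -/
theorem pureBoost_mul_translation (v : Space) (τ : ℝ) (a : Space) :
    pureBoost v * translation τ a =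
      central (inner ℝ v a + inner ℝ v v * τ / 2) * translation τ (a + τ • v) * pureBoost v := by
  ext1 <;> simp [central, translation, pureBoost, rotate_one, rotate_zero]

theorem continuous_translation : Continuous fun p : Spacetime => translation p.1 p.2 := by
  refine continuous_induced_rng.2 ?_
  change Continuous fun p : Spacetime => ((0 : ℝ), p.1, p.2, (0 : Space), (1 : Rotation))
  fun_prop

theorem continuous_pureBoost : Continuous pureBoost := by
  refine continuous_induced_rng.2 ?_
  change Continuous fun v : Space => ((0 : ℝ), (0 : ℝ), (0 : Space), v, (1 : Rotation))
  fun_prop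

end Bargmann

open Bargmann

/-! ### The mass spectrum: a massless vacuum and no negative masses. -/

namespace GalileanNet

variable {H : Type*} [NormedAddCommGroup H] [InnerProductSpace ℂ H] [CompleteSpace H]

/-- The unitary operator of a group element, as a bounded operator. -/
def act (N : GalileanNet H) (g : Bargmann) : H →L[ℂ] H := N.U g

theorem act_mul (N : GalileanNet H) (g h : Bargmann) (x : H) :
    N.act (g * h) x = N.act g (N.act h x) := by
  simp [act]

theorem act_one (N : GalileanNet H) : N.act 1 = 1 := by
  simp [act]

theorem inner_act (N : GalileanNet H) (g : Bargmann) (x y : H) :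
    inner ℂ (N.act g x) (N.act g y) = inner ℂ x y :=
  ContinuousLinearMap.inner_map_map_of_mem_unitary (N.U g).2 x y

/-- The vacuum has mass zero. -/
theorem act_central_vacuum (N : GalileanNet H) (θ : ℝ) : N.act (central θ) N.Ω = N.Ω := by
  obtain ⟨c, hc⟩ := N.vacuum_unique (N.act (central θ) N.Ω) fun τ a => by
    change N.act (translation τ a) _ = _
    rw [← act_mul, ← central_comm, act_mul]
    congr 1
    exact N.vacuum_invariant τ a
  by_contra hne
  have hc1 : c ≠ 1 := fun h => hne (by rw [hc, h, one_smul])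
  have hinv : ∀ τ a, N.act (translation τ a) N.Ω = N.Ω := N.vacuum_invariant
  -- Choosing `v · a = θ`, moving the translation past the boost costs the factor `c`, while
  -- translations fix `Ω`; so the matrix element equals `c` times itself. As `v → 0` it tends to
  -- `‖Ω‖²`, a contradiction.
  have horth : ∀ v : Space, v ≠ 0 → inner ℂ N.Ω (N.act (pureBoost v) N.Ω) = 0 := by
    intro v hv
    have hvv : inner ℝ v v ≠ 0 := inner_self_ne_zero.2 hv
    set a : Space := (θ / inner ℝ v v) • v
    have hva : inner ℝ v a = θ := by
      rw [inner_smul_right, div_mul_cancel₀ _ hvv]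
    have h := congrArg (fun g => N.act g N.Ω) (pureBoost_mul_translation v 0 a)
    simp only [hva, mul_zero, zero_div, add_zero, zero_smul] at h
    rw [mul_assoc, central_comm, mul_assoc, act_mul, act_mul, act_mul, hinv, hc,
      map_smul, map_smul] at h
    have h2 := congrArg (inner ℂ N.Ω) h
    rw [inner_smul_right] at h2
    conv_rhs at h2 => rw [← hinv 0 a, inner_act, hinv]
    have h3 : (1 - c) * inner ℂ N.Ω (N.act (pureBoost v) N.Ω) = 0 := by linear_combination h2
    exact (mul_eq_zero.1 h3).resolve_left (sub_ne_zero.2 hc1.symm)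
  have hcont : Continuous fun v : Space => inner ℂ N.Ω (N.act (pureBoost v) N.Ω) :=
    continuous_const.inner ((N.U_continuous N.Ω).comp continuous_pureBoost)
  have hzero := hcont.ext_on (dense_compl_singleton (0 : Space)) continuous_const
    (fun v hv => horth v hv)
  have h0 := congrFun hzero 0
  have hb : pureBoost 0 = 1 := rfl
  simp only [hb, act_one, one_apply_eq_self, inner_self_eq_zero] at h0
  have := N.norm_vacuum
  rw [h0, norm_zero] at this
  exact zero_ne_one this

/-- A nonzero vector can be averaged over the translations to a nonzero vector with a
differentiable orbit and the same behaviour under the central subgroup. -/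
theorem exists_smooth_vector (N : GalileanNet H) (c : ℝ → ℂ) (x : H) (hx : x ≠ 0)
    (hc : ∀ θ, N.act (central θ) x = c θ • x) :
    ∃ y : H, y ≠ 0 ∧ (∀ θ, N.act (central θ) y = c θ • y) ∧
      Differentiable ℝ fun p : Spacetime => N.act (translation p.1 p.2) y := by
  have : (volume : Measure Spacetime).IsAddHaarMeasure := by
    rw [Measure.volume_eq_prod]
    infer_instance
  set F : Spacetime → H := fun p => N.act (translation p.1 p.2) x
  have hF : Continuous F := (N.U_continuous x).comp continuous_translation
  have hF0 : F 0 = x := by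
    change N.act (translation 0 0) x = x
    rw [translation_zero, act_one, one_apply_eq_self]
  -- Averaging over a ball where the orbit stays within `‖x‖ / 2` of `x` cannot give zero.
  obtain ⟨δ, hδ, hball⟩ := Metric.continuousAt_iff.1 (hF.continuousAt (x := 0)) (‖x‖ / 2)
    (half_pos (norm_pos_iff.2 hx))
  let φ : ContDiffBump (0 : Spacetime) := ⟨δ / 2, δ, half_pos hδ, half_lt_self hδ⟩
  have hint : ∀ q : Spacetime, Integrable fun t => φ.normed volume t • F (q - t) := fun q =>
    Continuous.integrable_of_hasCompactSupport
      (φ.continuous_normed.smul (hF.comp (continuous_const.sub continuous_id)))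
      φ.hasCompactSupport_normed.smul_right
  set y : H := ∫ t, φ.normed volume t • F (0 - t)
  -- The orbit of the average is a convolution with the bump, so it inherits the smoothness of the
  -- bump.
  have hy : ∀ q : Spacetime, N.act (translation q.1 q.2) y =
      convolution (φ.normed volume) F (ContinuousLinearMap.lsmul ℝ ℝ) volume q := by
    intro q
    rw [convolution_def, ← ContinuousLinearMap.integral_comp_comm _ (hint 0)]
    congr 1
    funext t
    rw [ContinuousLinearMap.map_smul_of_tower]
    simp only [F, ContinuousLinearMap.lsmul_apply]
    rw [← act_mul, translation_mul, zero_sub, ← sub_eq_add_neg]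
  refine ⟨y, ?_, ?_, ?_⟩
  · intro h0
    have hd := φ.dist_normed_convolution_le (μ := (volume : Measure Spacetime)) (g := F) (x₀ := 0)
      (ε := ‖x‖ / 2) hF.aestronglyMeasurable (fun z hz => (hball hz).le)
    rw [← hy, h0, map_zero, hF0, dist_zero_left] at hd
    have := norm_pos_iff.2 hx
    linarith
  · intro θ
    rw [← ContinuousLinearMap.integral_comp_comm _ (hint 0), ← integral_smul]
    congr 1
    funext t
    rw [ContinuousLinearMap.map_smul_of_tower, smul_comm]
    congr 1
    simp only [F]
    rw [← act_mul, central_comm, act_mul, hc, map_smul]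
  · have hsm := φ.hasCompactSupport_normed.contDiff_convolution_left (n := 1)
      (ContinuousLinearMap.lsmul ℝ ℝ : ℝ →L[ℝ] H →L[ℝ] H) (φ.contDiff_normed (μ := volume))
      hF.locallyIntegrable (μ := (volume : Measure Spacetime))
    simp only [hy]
    exact hsm.differentiable (by simp)

/-- Positivity of the energy in all boosted frames excludes negative masses. -/
theorem eq_zero_of_negative_mass (N : GalileanNet H) {m : ℝ} (hm : 0 < m) (x : H)
    (hx : ∀ θ : ℝ, N.act (central θ) x = Complex.exp (Complex.I * θ * (-m : ℝ)) • x) : x = 0 := by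
  by_contra hne
  obtain ⟨y, hy0, hy, hdiff⟩ := N.exists_smooth_vector _ x hne hx
  set F : Spacetime → H := fun p => N.act (translation p.1 p.2) y
  have hF0 : F 0 = y := by
    change N.act (translation 0 0) y = y
    rw [translation_zero, act_one, one_apply_eq_self]
  set D := fderiv ℝ F 0
  have key : ∀ v : Space, 0 ≤ -(m * inner ℝ v v / 2) * ‖y‖ ^ 2 +
      (inner ℂ y (-Complex.I • D (1, v))).re := by
    intro v
    set b := pureBoost v
    -- Seen from the boosted frame, time evolution runs along the line `(t, t v)` with a phase. This
    -- is why joint differentiability in space and time is needed.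
    have horbit : ∀ t : ℝ, N.act (translation t 0) (N.act b⁻¹ y) =
        N.act b⁻¹ (Complex.exp (Complex.I * (inner ℝ v v * t / 2 : ℝ) * (-m : ℝ)) • F (t, t • v)) := by
      intro t
      have h := pureBoost_mul_translation v t 0
      have h' : translation t 0 * b⁻¹ =
          b⁻¹ * (translation t (t • v) * central (inner ℝ v v * t / 2)) := by
        rw [eq_inv_mul_iff_mul_eq, ← mul_assoc, mul_inv_eq_iff_eq_mul, h, central_comm]
        simp [b]
      rw [← act_mul, h', act_mul, act_mul, hy, map_smul]
    have hexp : HasDerivAt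
        (fun t : ℝ => Complex.exp (Complex.I * (inner ℝ v v * t / 2 : ℝ) * (-m : ℝ)))
        (Complex.I * (inner ℝ v v / 2 : ℝ) * (-m : ℝ)) 0 := by
      have h1 : HasDerivAt (fun t : ℝ => ((inner ℝ v v * t / 2 : ℝ) : ℂ))
          ((inner ℝ v v / 2 : ℝ) : ℂ) 0 := by
        have h2 : HasDerivAt (fun t : ℝ => inner ℝ v v * t / 2) (inner ℝ v v / 2) 0 := by
          simpa using ((hasDerivAt_id (0 : ℝ)).const_mul (inner ℝ v v)).div_const 2
        exact h2.ofReal_comp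
      simpa using ((h1.const_mul Complex.I).mul_const ((-m : ℝ) : ℂ)).cexp
    have hcurve : HasDerivAt (fun t : ℝ => F (t, t • v)) (D (1, v)) 0 := by
      have h1 : HasDerivAt (fun t : ℝ => ((t, t • v) : Spacetime)) (1, v) 0 := by
        have := (hasDerivAt_id (0 : ℝ)).prodMk ((hasDerivAt_id (0 : ℝ)).smul_const v)
        simpa using this
      have h2 : HasFDerivAt F D ((fun t : ℝ => ((t, t • v) : Spacetime)) 0) := by
        have : ((0 : ℝ), (0 : ℝ) • v) = (0 : Spacetime) := by simp
        simp only [this]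
        exact (hdiff 0).hasFDerivAt
      exact h2.comp_hasDerivAt 0 h1
    set w : H := D (1, v) + (Complex.I * (inner ℝ v v / 2 : ℝ) * (-m : ℝ)) • y
    have hder : HasDerivAt (fun t : ℝ => N.act (translation t 0) (N.act b⁻¹ y)) (N.act b⁻¹ w) 0 := by
      have h1 := hexp.smul hcurve
      have h2 := ((N.act b⁻¹).restrictScalars ℝ).hasFDerivAt.comp_hasDerivAt (0 : ℝ) h1
      have h3 : F (0, 0) = y := hF0
      simp only [horbit]
      simpa [h3, w, Function.comp_def] using h2
    have hsymm := generator_symmetric (fun t => N.act (translation t 0))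
      (by rw [translation_zero, act_one]) (fun t => N.inner_act _)
    have hpos := re_inner_apply_nonneg_of_spectrum _ hsymm N.positive_energy
      ⟨N.act b⁻¹ y, hder.differentiableAt⟩
    have hgen : generator (fun t => N.act (translation t 0))
        ⟨N.act b⁻¹ y, hder.differentiableAt⟩ = N.act b⁻¹ (-Complex.I • w) := by
      rw [map_smul]
      exact congrArg (-Complex.I • ·) hder.deriv
    rw [hgen, inner_act] at hpos
    have hw : -Complex.I • w = -Complex.I • D (1, v) + ((-(m * inner ℝ v v / 2) : ℝ) : ℂ) • y := by
      simp only [w, smul_add, smul_smul]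
      congr 2
      push_cast
      linear_combination ((inner ℝ v v : ℝ) : ℂ) / 2 * m * Complex.I_sq
    rw [hw, inner_add_right, inner_smul_right y y, Complex.add_re,
      Complex.re_ofReal_mul] at hpos
    have hn : (inner ℂ y y).re = ‖y‖ ^ 2 := inner_self_eq_norm_sq (𝕜 := ℂ) y
    rw [hn] at hpos
    linarith
  set q : ℝ := (inner ℂ y (-Complex.I • D (1, 0))).re
  -- Adding the bounds for `v` and `-v` cancels the momentum term.
  have hquad : ∀ v : Space, m * inner ℝ v v * ‖y‖ ^ 2 ≤ 2 * q := by
    intro v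
    have h1 := key v
    have h2 := key (-v)
    have hD : D (1, v) + D (1, -v) = D (1, 0) + D (1, 0) := by
      rw [← map_add, ← map_add]
      simp
    have h3 : (inner ℂ y (-Complex.I • D (1, v))).re + (inner ℂ y (-Complex.I • D (1, -v))).re =
        q + q := by
      rw [← Complex.add_re, ← inner_add_right, ← smul_add, hD, smul_add, inner_add_right,
        Complex.add_re]
    rw [inner_neg_neg] at h2
    linarith
  have hmy : 0 < m * ‖y‖ ^ 2 := by
    have := norm_pos_iff.2 hy0
    positivity
  -- Large enough that `m ‖y‖² s > 2 |q|`; the final `+ 1` ensures `s ≤ s²`.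
  set s : ℝ := (2 * |q| + 1) / (m * ‖y‖ ^ 2) + 1
  have hs1 : 1 ≤ s := le_add_of_nonneg_left (by positivity)
  have h := hquad (EuclideanSpace.single 0 s)
  have hn : inner ℝ (EuclideanSpace.single 0 s : Space) (EuclideanSpace.single 0 s) = s ^ 2 := by
    rw [real_inner_self_eq_norm_sq]
    simp
  rw [hn] at h
  have h1 : m * ‖y‖ ^ 2 * s = 2 * |q| + 1 + m * ‖y‖ ^ 2 := by
    simp only [s]
    field_simp
  have h2 : m * ‖y‖ ^ 2 * s ≤ m * ‖y‖ ^ 2 * s ^ 2 :=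
    mul_le_mul_of_nonneg_left (by nlinarith) hmy.le
  linarith [le_abs_self q]

/-- A field that carries a negative mass charge annihilates the vacuum. -/
theorem field_vacuum (N : GalileanNet H) {m : ℝ} (hm : 0 < m) {T : H →ₗ.[ℂ] H}
    (hT : HasCharge N.massGroup T (-m)) (hΩ : N.Ω ∈ T.domain) : T ⟨N.Ω, hΩ⟩ = 0 := by
  refine N.eq_zero_of_negative_mass hm _ fun θ => ?_
  obtain ⟨h, e⟩ := hT θ ⟨N.Ω, hΩ⟩
  have hv : N.massGroup θ N.Ω = N.Ω := N.act_central_vacuum θ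
  have : (⟨N.massGroup θ N.Ω, h⟩ : T.domain) = ⟨N.Ω, hΩ⟩ := Subtype.ext hv
  rw [this] at e
  exact e

end GalileanNet

/-! ### Test functions: bumps, tensor products and delta sequences. -/

/-- A smooth bump function as a complex test function. -/
def Test.ofBump {E : Type} [NormedAddCommGroup E] [NormedSpace ℝ E] [FiniteDimensional ℝ E]
    {c : E} (φ : ContDiffBump c) : Test E where
  toFun x := (φ x : ℂ)
  contDiff' := Complex.ofRealCLM.contDiff.comp φ.contDiff
  hasCompactSupport' := φ.hasCompactSupport.comp_left Complex.ofReal_zero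
  tsupport_subset' := by simp

/-- A normalized smooth bump function as a complex test function. -/
def Test.ofNormedBump {c : ℝ} (φ : ContDiffBump c) : Test ℝ where
  toFun x := (φ.normed volume x : ℂ)
  contDiff' := Complex.ofRealCLM.contDiff.comp φ.contDiff_normed
  hasCompactSupport' := φ.hasCompactSupport_normed.comp_left Complex.ofReal_zero
  tsupport_subset' := by simp

theorem Test.ofBump_apply {E : Type} [NormedAddCommGroup E] [NormedSpace ℝ E]
    [FiniteDimensional ℝ E] {c : E} (φ : ContDiffBump c) (x : E) : Test.ofBump φ x = (φ x : ℂ) :=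
  rfl

theorem Test.ofNormedBump_apply {c : ℝ} (φ : ContDiffBump c) (t : ℝ) :
    Test.ofNormedBump φ t = (φ.normed volume t : ℂ) :=
  rfl

theorem Test.tsupport_ofBump_subset {E : Type} [NormedAddCommGroup E] [NormedSpace ℝ E]
    [FiniteDimensional ℝ E] {c : E} (φ : ContDiffBump c) :
    tsupport (Test.ofBump φ) ⊆ Metric.closedBall c φ.rOut := by
  rw [← φ.tsupport_eq]
  exact tsupport_comp_subset Complex.ofReal_zero φ

theorem Test.tsupport_ofNormedBump_subset {c : ℝ} (φ : ContDiffBump c) :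
    tsupport (Test.ofNormedBump φ) ⊆ Metric.closedBall c φ.rOut := by
  rw [← φ.tsupport_normed_eq (μ := volume)]
  exact tsupport_comp_subset Complex.ofReal_zero (φ.normed volume)

theorem Test.tsupport_tensor_subset (χ : Test ℝ) (g : Test Space) :
    tsupport (Test.tensor χ g) ⊆ tsupport χ ×ˢ tsupport g := by
  refine closure_minimal (fun p hp => ?_) ((isClosed_tsupport _).prod (isClosed_tsupport _))
  have hp' : χ p.1 * g p.2 ≠ 0 := hp
  exact ⟨subset_tsupport _ (left_ne_zero_of_mul hp'), subset_tsupport _ (right_ne_zero_of_mul hp')⟩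

theorem exists_isDeltaSequence : ∃ χ : ℕ → Test ℝ, IsDeltaSequence χ := by
  have hpos : ∀ n : ℕ, (0 : ℝ) < 1 / ((n : ℝ) + 1) := fun n => by positivity
  let φ : ℕ → ContDiffBump (0 : ℝ) := fun n =>
    ⟨1 / ((n : ℝ) + 1) / 2, 1 / ((n : ℝ) + 1), half_pos (hpos n), half_lt_self (hpos n)⟩
  have hlim : Tendsto (fun n => (φ n).rOut) atTop (𝓝 0) := tendsto_one_div_add_atTop_nhds_zero_nat
  refine ⟨fun n => Test.ofNormedBump (φ n), ⟨fun n => ?_, fun f => ?_, fun δ hδ => ?_⟩⟩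
  · simp only [Test.ofNormedBump_apply]
    rw [integral_complex_ofReal, (φ n).integral_normed, Complex.ofReal_one]
  -- The reflection turns the pairing with `f` into a convolution evaluated at `0`.
  · have hf : Continuous fun t : ℝ => f (-t) := f.continuous.comp continuous_neg
    have h := ContDiffBump.convolution_tendsto_right (μ := (volume : Measure ℝ)) (φ := φ)
      (g := fun _ t => f (-t)) (k := fun _ => 0) (x₀ := 0) (z₀ := f 0) hlim
      (Eventually.of_forall fun _ => hf.aestronglyMeasurable) (by
        have : Tendsto (fun t : ℝ => f (-t)) (𝓝 0) (𝓝 (f 0)) := by simpa using hf.tendsto 0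
        exact this.comp tendsto_snd) tendsto_const_nhds
    simpa [convolution_def, Test.ofNormedBump_apply] using h
  · filter_upwards [hlim.eventually_lt_const hδ] with n hn
    exact (Test.tsupport_ofNormedBump_subset _).trans (Metric.closedBall_subset_ball hn)

theorem integral_conj_ofBump_mul_ne_zero {c : Space} (φ : ContDiffBump c) :
    ∫ y, conj (Test.ofBump φ y) * Test.ofBump φ y ≠ 0 := by
  have h : ∀ y, conj (Test.ofBump φ y) * Test.ofBump φ y = ((φ y * φ y : ℝ) : ℂ) := fun y => by
    rw [Test.ofBump_apply, Complex.conj_ofReal, Complex.ofReal_mul]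
  simp only [h]
  rw [integral_complex_ofReal]
  have hpos : 0 < ∫ y, φ y * φ y :=
    (φ.continuous.mul φ.continuous).integral_pos_of_hasCompactSupport_nonneg_nonzero
      φ.hasCompactSupport.mul_right (fun y => mul_self_nonneg _) (x := c)
      (by simp [φ.one_of_mem_closedBall (Metric.mem_closedBall_self φ.rIn_pos.le)])
  exact_mod_cast hpos.ne'

/-! ### Annihilators of the vacuum in the local algebras. -/

namespace GalileanNet

variable {H : Type*} [NormedAddCommGroup H] [InnerProductSpace ℂ H] [CompleteSpace H]

/-- The algebra of a region that meets time zero contains an annihilator of the vacuum whose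
adjoint does not annihilate the vacuum. -/
theorem exists_annihilator_of_mem_time_zero (N : GalileanNet H) {m₀ : ℝ} (hm₀ : 0 < m₀)
    (hcharge : N.FieldsHaveMassCharge m₀) (T : TimeZeroFields N) (hCCR : T.CCR)
    {O : Set Spacetime} (hO : IsRegion O) {x₀ : Space} (hx₀ : ((0, x₀) : Spacetime) ∈ O) :
    ∃ A ∈ N.alg O, A N.Ω = 0 ∧ star A N.Ω ≠ 0 := by
  by_contra! hcon
  obtain ⟨ε, hε, hball⟩ := Metric.isOpen_iff.1 hO.1 _ hx₀
  obtain ⟨χ, hχ⟩ := exists_isDeltaSequence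
  let φ : ContDiffBump x₀ :=
    ⟨ε / 2 / 2, ε / 2, half_pos (half_pos hε), half_lt_self (half_pos hε)⟩
  let g := Test.ofBump φ
  let Ω : T.dom := ⟨N.Ω, T.vacuum_mem⟩
  have hvac : ∀ n, N.ψ (Test.tensor (χ n) g) ⟨N.Ω, T.dom_le (χ n) g T.vacuum_mem⟩ = 0 :=
    fun n => N.field_vacuum hm₀ (hcharge _).1 _
  have hann : T.ψ₀ g Ω = 0 := by
    have h := T.limit χ hχ g Ω
    have h0 : (fun n => N.ψ (Test.tensor (χ n) g) ⟨Ω, T.dom_le (χ n) g Ω.2⟩) = fun _ => 0 :=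
      funext hvac
    rw [h0] at h
    exact Subtype.ext (tendsto_nhds_unique h tendsto_const_nhds)
  -- For large `n` the smeared field is localized in `O`, so by `hcon` its range is orthogonal to
  -- `Ω`; orthogonality survives the limit.
  have horth : ∀ x : T.dom, inner ℂ N.Ω (T.ψ₀ g x : H) = 0 := by
    intro x
    have h := (tendsto_const_nhds (x := N.Ω)).inner (𝕜 := ℂ) (T.limit χ hχ g x)
    refine tendsto_nhds_unique h (tendsto_const_nhds.congr' ?_)
    filter_upwards [hχ.support_shrinks ε hε] with n hn
    have hsupp : tsupport (Test.tensor (χ n) g) ⊆ O := by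
      refine (Test.tsupport_tensor_subset _ _).trans (Set.Subset.trans ?_ hball)
      rw [← ball_prod_same]
      exact Set.prod_mono hn ((Test.tsupport_ofBump_subset φ).trans
        (Metric.closedBall_subset_ball (half_lt_self hε)))
    obtain ⟨A, hA, h1, h2⟩ := (N.field_affiliated O hO _ hsupp).exists_annihilator _ (hvac n)
    exact (h2 (hcon A hA h1) ⟨x, T.dom_le (χ n) g x.2⟩).symm
  -- `‖ψ₀†(g) Ω‖² = ⟨Ω, ψ₀(g) ψ₀†(g) Ω⟩`, which uses that the domain is stable under `ψ₀†(g)`.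
  have hdag : T.ψ₀dag g Ω = 0 := by
    refine Subtype.ext (inner_self_eq_zero (𝕜 := ℂ).1 ?_)
    rw [T.adjoint]
    exact horth _
  have hc := (hCCR g g Ω).1
  rw [hann, hdag, map_zero, map_zero, sub_zero] at hc
  have hΩ : Ω ≠ 0 := fun h => by
    have h' : N.Ω = 0 := congrArg Subtype.val h
    have := N.norm_vacuum
    rw [h', norm_zero] at this
    exact zero_ne_one this
  exact (smul_ne_zero (integral_conj_ofBump_mul_ne_zero φ) hΩ) hc.symm

/-- The algebra of every nonempty region contains an annihilator of the vacuum whose adjoint does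
not annihilate the vacuum. -/
theorem exists_annihilator (N : GalileanNet H) {m₀ : ℝ} (hm₀ : 0 < m₀)
    (hcharge : N.FieldsHaveMassCharge m₀) (T : TimeZeroFields N) (hCCR : T.CCR)
    {O : Set Spacetime} (hO : IsRegion O) (hne : O.Nonempty) :
    ∃ A ∈ N.alg O, A N.Ω = 0 ∧ star A N.Ω ≠ 0 := by
  obtain ⟨⟨t, x₀⟩, hp⟩ := hne
  set g := translation (-t) 0
  have hg : (fun p : Spacetime => g • p) = fun p => p + (-t, 0) := by
    funext p
    change (p.1 + -t, rotate 1 p.2 + p.1 • (0 : Space) + 0) = _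
    rw [rotate_one, smul_zero, add_zero]
    rfl
  have hO' : IsRegion ((fun p => g • p) '' O) := by
    rw [hg]
    exact ⟨(Homeomorph.addRight ((-t, 0) : Spacetime)).isOpenMap _ hO.1,
      ((LipschitzWith.id.add (LipschitzWith.const _)).isBounded_image hO.2)⟩
  have hmem : ((0, x₀) : Spacetime) ∈ (fun p => g • p) '' O := ⟨_, hp, by rw [hg]; simp⟩
  obtain ⟨A, hA, hA0, hA1⟩ :=
    N.exists_annihilator_of_mem_time_zero hm₀ hcharge T hCCR hO' hmem
  set V : H →L[ℂ] H := (N.U g : H →L[ℂ] H)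
  have hVl : star V * V = 1 := Unitary.coe_star_mul_self (N.U g)
  have hVr : V * star V = 1 := Unitary.coe_mul_star_self (N.U g)
  have hΩ : V N.Ω = N.Ω := N.vacuum_invariant (-t) 0
  -- Conjugating back to `O` keeps both properties because `V` fixes the vacuum.
  refine ⟨star V * A * V, (N.covariance g O hO _).1 ?_, ?_, ?_⟩
  · have : V * (star V * A * V) * star V = (V * star V) * A * (V * star V) := by
      simp only [mul_assoc]
    change V * (star V * A * V) * star V ∈ _
    rwa [this, hVr, one_mul, mul_one]
  · simp only [mul_apply_eq_comp, hΩ, hA0, map_zero]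
  · intro h
    simp only [star_mul, star_star, mul_apply_eq_comp, hΩ] at h
    have h' := congrArg V h
    rw [map_zero, ← mul_apply_eq_comp, hVr] at h'
    exact hA1 h'

end GalileanNet

end GalileanAQFT

end

theorem mainTheorem7 {H : Type*} [NormedAddCommGroup H] [InnerProductSpace ℂ H] [CompleteSpace H]
    (N : GalileanAQFT.GalileanNet H)
    (m₀ : ℝ) (hm₀ : 0 < m₀) (hcharge : N.FieldsHaveMassCharge m₀)
    (T : GalileanAQFT.GalileanNet.TimeZeroFields N) (hCCR : T.CCR)
    (O : Set GalileanAQFT.Spacetime) (hO : IsOpen O) (hbounded : Bornology.IsBounded O)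
    (hne : O.Nonempty) (hcompl : (interior Oᶜ).Nonempty) :
    ¬ GalileanAQFT.IsSeparating (N.alg O) N.Ω ∧
      ¬ ∃ S, GalileanAQFT.IsTomitaOperator (N.alg O) N.Ω S := by
  obtain ⟨A, hA, h0, h1⟩ := N.exists_annihilator hm₀ hcharge T hCCR ⟨hO, hbounded⟩ hne
  refine ⟨fun hsep => h1 (by rw [hsep A hA h0, star_zero, zero_apply]), ?_⟩
  rintro ⟨S, hS⟩
  -- `A Ω` is the zero vector, so additivity gives `S (A Ω) = 0`, whereas the Tomita relation
  -- demands `A* Ω ≠ 0`.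
  have hmem : A N.Ω ∈ S.domain := by rw [h0]; exact S.domain.zero_mem
  refine h1 ?_
  rw [← hS.apply_eq A hA hmem, show (⟨A N.Ω, hmem⟩ : S.domain) = 0 from Subtype.ext h0, S.map_zero]
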